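/- Let $q$ be a prime power and let $m,n,h$ be integers with $m\ge 3$ and $2\le h\le n-3$; write $V(r,q^n)$ for an $r$-dimensional $\mathbb F_{q^n}$-vector space. *Scattered subspaces.* For $0<h\le r-1$, an $\mathbb F_q$-subspace $U$ of $V=V(r,q^n)$ is $h$-scattered if $\langle U\rangle_{\mathbb F_{q^n}}=V$ and $\dim_{\mathbb F_q}(U\cap H)\le h$ for every $h$-dimensional $\mathbb F_{q^n}$-subspace $H$ of $V$; it is maximum $h$-scattered if its dimension is the largest among all $h$-scattered subspaces of $V$. *Codes and generalized weights.* Let $U$ be an $\mathbb F_q$-subspace of $\mathbb F_{q^n}^k$ with $\dim_{\mathbb F_q}U=t$ that spans $\mathbb F_{q^n}^k$ over $\mathbb F_{q^n}$. A code associated with $U$ is an $\mathbb F_{q^n}$-linear code $\mathcal D\subseteq\mathbb F_{q^n}^t$ of dimension $k$ that has a generator matrix whose columns form an $\mathbb F_q$-basis of $U$. For $1\le\rho\le k-1$ its $\rho$-th generalized rank weight is $$d_\rho(\mathcal D)=t-\max\{\dim_{\mathbb F_q}(U\cap H): H\le \mathbb F_{q^n}^k,\ \dim_{\mathbb F_{q^n}}H=k-\rho\},$$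 which depends only on $\mathcal D$ and not on the choice of the associated $U$. *The family.* For $\mathbf A=(\alpha_1,\dots,\alpha_m)$ with $\alpha_i\in\mathbb F_{q^n}^*$ let $$V_{\mathbf A,h}=\{(\underline x,\underline x^{q},\dots,\underline x^{q^{h-1}},f_1(\underline x),\dots,f_m(\underline x)):\underline x\in\mathbb F_{q^n}^m\}\subseteq\mathbb F_{q^n}^{m(h+1)},$$ where $f_i(\underline x)=x_i^{q^h}+\alpha_{i+1}x_{i+1}^{q^{h+1}}$ (indices modulo $m$ in $\{1,\dots,m\}$, so $f_m(\underline x)=x_m^{q^h}+\alpha_1x_1^{q^{h+1}}$). Let $K_{\mathbf A}=\alpha_1^{q^{m-1}}\alpha_2\alpha_3^{q}\cdots\alpha_m^{q^{m-2}}$ and let $\mathcal A$ be the set of those $\mathbf A$ for which $K_{\mathbf A}$ is not a $(1+q+\cdots+q^{m-1})$-th power in $\mathbb F_{q^n}$. Let $\Pi_i=\alpha_i^{q^{m-1}}\alpha_{i-1}^{q^{m-2}}\cdots\alpha_{i+2}^{q}\alpha_{i+1}$ (indices modulo $m$) and let $\mathcal B$ be the set of those $\mathbf A\in\mathcal A$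 for which $\Pi_{\delta+2}/\Pi_2$ is not a $(q^m-1)$-th power in $\mathbb F_{q^n}$ for any $\delta=1,\dots,m-1$. **Theorem.** Let $\mathcal G_{\mathbf A,h}$ be a (necessarily MRD, when $\mathbf A\in\mathcal A$) code associated with $V_{\mathbf A,h}$, and let $\mathcal C$ be a (necessarily MRD) code associated with an $\mathbb F_q$-subspace $U$ of $V(m(h+1),q^n)$ that is a direct sum of $m$ maximum $h$-scattered $\mathbb F_q$-subspaces of spaces $V(h+1,q^n)$; that is, $V(m(h+1),q^n)=\bigoplus_{i=1}^mW_i$ with $\dim_{\mathbb F_{q^n}} W_i=h+1$, and $U=\bigoplus_{i=1}^m U_i$ with $U_i$ maximum $h$-scattered in $W_i$. Then: (a) if $2\le s\le m-2$, $n>(s+1)(h+1)$ and $\mathbf A\in\mathcal B$, then $d_{s(h+1)}(\mathcal G_{\mathbf A,h})>d_{s(h+1)}(\mathcal C)$; (b) if $n>2h+2$ and $\mathbf A\in\mathcal A$, then $d_{h+1}(\mathcal G_{\mathbf A,h})>d_{h+1}(\mathcal C)$; (c) if $\mathbf A\in\mathcal A$, then $d_{(m-1)(h+1)}(\mathcal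 G_{\mathbf A,h})>d_{(m-1)(h+1)}(\mathcal C)$. -/

import Mathlib

open Module

section Scattered

variable {F : Type*} (K : Type*) {V : Type*} [Field F] [Field K] [Algebra F K]
  [AddCommGroup V] [Module F V] [Module K V] [IsScalarTower F K V]

/-- The weight `dim_F (U ∩ H)` of a `K`-subspace `H` of `V` in an `F`-subspace `U` of `V`. -/
noncomputable def wt (U : Submodule F V) (H : Submodule K V) : ℕ :=
  finrank F ↥(U ⊓ H.restrictScalars F)

/-- The `F`-subspace `U` of the `K`-space `V` is `h`-scattered, where `0 < h ≤ dim_K V - 1`: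
`U` spans `V` over `K`, and every `h`-dimensional `K`-subspace of `V` meets `U` in an
`F`-subspace of dimension at most `h`. -/
structure IsHScattered (h : ℕ) (U : Submodule F V) : Prop where
  pos : 0 < h
  lt_finrank : h < finrank K V
  span_eq_top : Submodule.span K (U : Set V) = ⊤
  wt_le : ∀ H : Submodule K V, finrank K H = h → wt K U H ≤ h

/-- A maximum `h`-scattered subspace: an `h`-scattered subspace of highest possible dimension. -/
def IsMaximumHScattered (h : ℕ) (U : Submodule F V) : Prop :=
  IsHScattered K h U ∧
    ∀ U' : Submodule F V, IsHScattered K h U' → finrank F U' ≤ finrank F U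

/-- `V` is the direct sum of `m` subspaces `W i` with `dim_K (W i) = h + 1`, and `U` is the sum
of `F`-subspaces `U' i ⊆ W i`, where `U' i` is a maximum `h`-scattered subspace of `W i`. -/
def IsDirectSumOfMaximumHScattered (h m : ℕ) (U : Submodule F V) : Prop :=
  ∃ W : Fin m → Submodule K V, DirectSum.IsInternal W ∧ (∀ i, finrank K (W i) = h + 1) ∧
    ∃ U' : (i : Fin m) → Submodule F (W i),
      (∀ i, IsMaximumHScattered K h (U' i)) ∧
      U = ⨆ i, (U' i).map ((W i).subtype.restrictScalars F)

/-- The `ρ`-th generalized rank weight of a system `U` in `V`, namely `dim_F U` minus the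
largest weight in `U` of a `K`-subspace of `V` of codimension `ρ`. -/
noncomputable def systemGenWeight (U : Submodule F V) (ρ : ℕ) : ℕ :=
  finrank F U - sSup {w | ∃ H : Submodule K V, finrank K H + ρ = finrank K V ∧ w = wt K U H}

end Scattered

section Codes

variable {F K : Type*} [Field F] [Field K] [Algebra F K]

/-- The linear code `C` of length `t` is associated with the system `U`: some generator matrix
of `C` (its rows form a `K`-basis of `C`) has columns that form an `F`-basis of `U`. -/
def IsAssociated {ι : Type*} {t : ℕ} (U : Submodule F (ι → K))
    (C : Submodule K (Fin t → K)) : Prop :=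
  ∃ G : Matrix ι (Fin t) K,
    LinearIndependent K G.row ∧ Submodule.span K (Set.range G.row) = C ∧
    LinearIndependent F G.col ∧ Submodule.span F (Set.range G.col) = U

variable (F) in
/-- The `ρ`-th generalized rank weight of a (non-degenerate) linear code `C`: the `ρ`-th
generalized rank weight of a system associated with `C`. All systems associated with `C` are
linearly equivalent, so the set below has exactly one element. -/
noncomputable def codeGenWeight {t : ℕ} (C : Submodule K (Fin t → K)) (ρ : ℕ) : ℕ :=
  sInf {d | ∃ (k : ℕ) (U : Submodule F (Fin k → K)),
    IsAssociated U C ∧ d = systemGenWeight K U ρ}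

end Codes

section Family

variable (F : Type*) {K : Type*} [Field F] [Fintype F] [Field K] [Algebra F K]

theorem add_pow_card_pow_ext (j : ℕ) (a b : K) :
    (a + b) ^ Fintype.card F ^ j = a ^ Fintype.card F ^ j + b ^ Fintype.card F ^ j := by
  obtain ⟨p, hp⟩ := CharP.exists F
  have := charP_of_injective_algebraMap (algebraMap F K).injective p
  obtain ⟨k, hprime, hk⟩ := FiniteField.card F p
  have : Fact p.Prime := ⟨hprime⟩
  rw [hk, ← pow_mul]
  exact add_pow_char_pow a b p _

theorem smul_pow_card_pow_ext (j : ℕ) (c : F) (a : K) :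
    (c • a) ^ Fintype.card F ^ j = c • a ^ Fintype.card F ^ j := by
  rw [smul_pow, FiniteField.pow_card_pow]

/-- The `F`-linear map sending `x = (x_0, …, x_{m-1})` to
`(x, x^q, …, x^(q^(h-1)), f(x))`, where `q = |F|` and
`f_i(x) = x_i^(q^h) + α_{i+1} x_{i+1}^(q^(h+1))` with indices modulo `m` (addition in `Fin m`
is cyclic). The coordinate `(j, i)` is the `i`-th entry of the `j`-th block of length `m`. -/
noncomputable def vectorMap (h : ℕ) {m : ℕ} [NeZero m] (α : Fin m → K) :
    (Fin m → K) →ₗ[F] (Fin (h + 1) × Fin m → K) where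
  toFun x := fun p =>
    if (p.1 : ℕ) < h then x p.2 ^ Fintype.card F ^ (p.1 : ℕ)
    else x p.2 ^ Fintype.card F ^ h
      + α (p.2 + 1) * x (p.2 + 1) ^ Fintype.card F ^ (h + 1)
  map_add' x y := by
    funext p
    simp only [Pi.add_apply, add_pow_card_pow_ext]
    split_ifs
    · rfl
    · ring
  map_smul' c x := by
    funext p
    simp only [Pi.smul_apply, smul_pow_card_pow_ext, RingHom.id_apply]
    split_ifs
    · rfl
    · rw [smul_add, mul_smul_comm]

/-- The `F`-subspace `V_{A,h}` of `K^{m(h+1)}` attached to `A = α`. -/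
noncomputable def subspaceV (h : ℕ) {m : ℕ} [NeZero m] (α : Fin m → K) :
    Submodule F (Fin (h + 1) × Fin m → K) :=
  LinearMap.range (vectorMap F h α)

/-- `Π_i = α_{i+1} α_{i+2}^q ⋯ α_{i+m-1}^(q^(m-2)) α_i^(q^(m-1))`, with indices modulo `m`. -/
noncomputable def cyclicProd {m : ℕ} [NeZero m] (α : Fin m → K) (i : Fin m) : K :=
  ∏ k : Fin m, α (i + 1 + k) ^ Fintype.card F ^ (k : ℕ)

/-- The set `𝒜` of tuples of nonzero elements for which
`K_A = α_1^(q^(m-1)) α_2 α_3^q ⋯ α_m^(q^(m-2))`, the product `Π_1`, is not a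
`(1 + q + ⋯ + q^(m-1))`-th power in `K`. The indices `1, …, m` of the tuple are here
`0, …, m-1`. -/
def setA (K : Type*) [Field K] [Algebra F K] (m : ℕ) [NeZero m] : Set (Fin m → K) :=
  {α | (∀ i, α i ≠ 0) ∧
    ¬ ∃ y : K, y ^ (∑ k ∈ Finset.range m, Fintype.card F ^ k) = cyclicProd F α 0}

/-- The set `ℬ` of tuples in `𝒜` for which no quotient `Π_{δ+2} / Π_2` with `1 ≤ δ ≤ m - 1`
(indices modulo `m` in the range `1, …, m`) is a `(q^m - 1)`-th power in `K`. The index `2` is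
here `1`. -/
def setB (K : Type*) [Field K] [Algebra F K] (m : ℕ) [NeZero m] : Set (Fin m → K) :=
  {α | α ∈ setA F K m ∧ ∀ δ : Fin m, δ ≠ 0 →
    ¬ ∃ y : K, y ^ (Fintype.card F ^ m - 1) = cyclicProd F α (δ + 1) / cyclicProd F α 1}

end Family

/-!
# Generalized weights of the codes attached to `V_{A,h}`

Write `q = |F|`, `n = [K : F]`. The weights of the two codes are computed on associated systems
(`IsAssociated.codeGenWeight_eq`), and the strict inequalities come from comparing both sides with
`s n` for `ρ = s (h + 1)`.

If `U` is a direct sum of `m` scattered subspaces, each summand has dimension at most `n`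
(`IsHScattered.finrank_le`), and the sum `H` of all but `s` of the ambient summands has codimension
`s (h + 1)` and satisfies `dim U ≤ wt H + s n`. Hence `d_{s (h + 1)} ≤ s n`
(`IsDirectSumOfMaximumHScattered.systemGenWeight_le`).

For `V_{A,h}`, of dimension `m n`, it has to be shown that a subspace `H` of dimension `c (h + 1)`,
`c = m - s`, has weight less than `c n`. Let `Z ⊆ K^m` be the set of parameters `x` whose vector
lies in `H`, and let `X_j` be the `K`-span of the functions `x ↦ x_i ^ (q ^ k)`, `k < j`, on `Z`.
Applying the Frobenius to a relation shows that the increments `dim X_{j+1} - dim X_j` do not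
increase with `j`, while `X_n` consists of all `F`-linear maps from `Z` to `K`, so
`dim X_n = dim Z` (`frobSpan_finrank_eq_top`). If `dim Z ≥ c n`, the numerical hypotheses force the
increment at `j = h + 1` to be at least `c` (`finrank_leadSpace_le_of_large`,
`finrank_leadSpace_lt_of_small`). On the other hand the coordinates of `V_{A,h}`, being induced by
functionals on `H`, span at most `c (h + 1)` dimensions of functions on `Z`. Comparing dimensions,
all increments up to `j = h + 1` equal `c`, and the space `T ⊆ K^m` of linear relations among the
coordinates on `Z` has dimension `s` and is stable under a Frobenius-semilinear weighted cyclic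
shift (`leadSpace_zero_stable`).

Such a stable `T` does not exist. If `T` is a line or a hyperplane, following its generator or its
equation once around the cycle exhibits `Π_1` as a `(1 + q + ⋯ + q^(m-1))`-th power, up to
Frobenius roots, against `A ∈ 𝒜`. For other dimensions, the `m`-th power of the shift is a diagonal
semilinear map whose entries are pairwise inequivalent for `A ∈ ℬ`; a vector of minimal support in
`T` is then supported on one coordinate, and the shift moves it to all the others.
-/

/-! ### Frobenius powers of the coordinate functions -/

section FrobeniusSpan

variable {F K ι : Type*} [Field F] [Fintype F] [Field K] [Algebra F K]

/-- The function `z ↦ z_i ^ (q ^ j)` on an `F`-subspace `Z` of `K^ι`, as an `F`-linear map. -/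
def coordPow (Z : Submodule F (ι → K)) (j : ℕ) (i : ι) : Z →ₗ[F] K where
  toFun z := z.1 i ^ Fintype.card F ^ j
  map_add' x y := by simp [add_pow_card_pow_ext]
  map_smul' c x := by
    simp only [Submodule.coe_smul, Pi.smul_apply, smul_pow_card_pow_ext, RingHom.id_apply]

@[simp] theorem coordPow_apply (Z : Submodule F (ι → K)) (j : ℕ) (i : ι) (z : Z) :
    coordPow Z j i z = z.1 i ^ Fintype.card F ^ j := rfl

/-- Composition with the Frobenius `y ↦ y ^ q` of `K` over `F`. -/
noncomputable def frobTwist (Z : Submodule F (ι → K)) (f : Z →ₗ[F] K) : Z →ₗ[F] K :=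
  (FiniteField.frobeniusAlgHom F K).toLinearMap ∘ₗ f

@[simp] theorem frobTwist_apply (Z : Submodule F (ι → K)) (f : Z →ₗ[F] K) (z : Z) :
    frobTwist Z f z = f z ^ Fintype.card F := rfl

variable [Fintype ι]

/-- The `K`-linear map sending `a` to the function `z ↦ ∑ i, a_i z_i ^ (q ^ j)` on `Z`. -/
noncomputable def combPow (Z : Submodule F (ι → K)) (j : ℕ) :
    (ι → K) →ₗ[K] (Z →ₗ[F] K) :=
  Fintype.linearCombination K (coordPow Z j)

theorem combPow_eq (Z : Submodule F (ι → K)) (j : ℕ) (a : ι → K) :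
    combPow Z j a = ∑ i, a i • coordPow Z j i := rfl

@[simp] theorem combPow_apply (Z : Submodule F (ι → K)) (j : ℕ) (a : ι → K) (z : Z) :
    combPow Z j a z = ∑ i, a i * z.1 i ^ Fintype.card F ^ j := by
  simp [combPow_eq, LinearMap.sum_apply]

/-- The `K`-span of the functions `z ↦ z_i ^ (q ^ k)` on `Z` with `k < j`. -/
noncomputable def frobSpan (Z : Submodule F (ι → K)) : ℕ → Submodule K (Z →ₗ[F] K)
  | 0 => ⊥
  | j + 1 => frobSpan Z j ⊔ (combPow Z j).range

theorem frobSpan_zero (Z : Submodule F (ι → K)) : frobSpan Z 0 = ⊥ := rfl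

theorem frobSpan_succ (Z : Submodule F (ι → K)) (j : ℕ) :
    frobSpan Z (j + 1) = frobSpan Z j ⊔ (combPow Z j).range := rfl

theorem frobSpan_mono (Z : Submodule F (ι → K)) : Monotone (frobSpan Z) :=
  monotone_nat_of_le_succ fun _ => le_sup_left

theorem combPow_mem_frobSpan (Z : Submodule F (ι → K)) {j k : ℕ} (h : j < k) (a : ι → K) :
    combPow Z j a ∈ frobSpan Z k :=
  frobSpan_mono Z (Nat.succ_le_of_lt h) (le_sup_right (a := frobSpan Z j) ⟨a, rfl⟩)

theorem frobSpan_le {Z : Submodule F (ι → K)} {j : ℕ} {D : Submodule K (Z →ₗ[F] K)}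
    (h : ∀ k < j, ∀ i, coordPow Z k i ∈ D) : frobSpan Z j ≤ D := by
  induction j with
  | zero => exact bot_le
  | succ j ih =>
    refine sup_le (ih fun k hk => h k (hk.trans j.lt_succ_self)) ?_
    rintro _ ⟨a, rfl⟩
    rw [combPow_eq]
    exact D.sum_mem fun i _ => D.smul_mem _ (h j j.lt_succ_self i)

theorem coordPow_mem_frobSpan [DecidableEq ι] (Z : Submodule F (ι → K)) {j k : ℕ} (h : j < k)
    (i : ι) : coordPow Z j i ∈ frobSpan Z k := by
  have := combPow_mem_frobSpan Z h (Pi.single i 1)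
  rwa [combPow, Fintype.linearCombination_apply_single, one_smul] at this

theorem frobTwist_combPow (Z : Submodule F (ι → K)) (j : ℕ) (a : ι → K) :
    frobTwist Z (combPow Z j a) = combPow Z (j + 1) fun i => a i ^ Fintype.card F := by
  ext z
  have := map_sum (FiniteField.frobeniusAlgHom F K)
    (fun i => a i * z.1 i ^ Fintype.card F ^ j) Finset.univ
  simp only [FiniteField.coe_frobeniusAlgHom] at this
  simp only [frobTwist_apply, combPow_apply, this, mul_pow, ← pow_mul, pow_succ]

theorem frobTwist_mem_frobSpan (Z : Submodule F (ι → K)) {j : ℕ} {f : Z →ₗ[F] K}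
    (hf : f ∈ frobSpan Z j) : frobTwist Z f ∈ frobSpan Z (j + 1) := by
  induction j generalizing f with
  | zero =>
    rw [frobSpan_zero, Submodule.mem_bot] at hf
    have : frobTwist Z f = 0 := by simp [frobTwist, hf]
    exact this ▸ Submodule.zero_mem _
  | succ j ih =>
    obtain ⟨u, hu, _, ⟨a, rfl⟩, rfl⟩ := Submodule.mem_sup.1 hf
    have : frobTwist Z (u + combPow Z j a) = frobTwist Z u + frobTwist Z (combPow Z j a) :=
      LinearMap.comp_add _ _ _
    rw [this, frobTwist_combPow]
    exact add_mem (frobSpan_mono Z j.succ.le_succ (ih hu))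
      (combPow_mem_frobSpan Z j.succ.lt_succ_self _)

/-- The tuples `a` for which `z ↦ ∑ i, a_i z_i ^ (q ^ j)` is a combination of lower Frobenius
powers of the coordinates. -/
noncomputable def leadSpace (Z : Submodule F (ι → K)) (j : ℕ) : Submodule K (ι → K) :=
  (frobSpan Z j).comap (combPow Z j)

theorem mem_leadSpace {Z : Submodule F (ι → K)} {j : ℕ} {a : ι → K} :
    a ∈ leadSpace Z j ↔ combPow Z j a ∈ frobSpan Z j := Iff.rfl

theorem pow_card_mem_leadSpace {Z : Submodule F (ι → K)} {j : ℕ} {a : ι → K}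
    (ha : a ∈ leadSpace Z j) : (fun i => a i ^ Fintype.card F) ∈ leadSpace Z (j + 1) := by
  rw [mem_leadSpace, ← frobTwist_combPow]
  exact frobTwist_mem_frobSpan Z ha

theorem pow_card_pow_mem_leadSpace {Z : Submodule F (ι → K)} {a : ι → K}
    (ha : a ∈ leadSpace Z 0) (j : ℕ) : (fun i => a i ^ Fintype.card F ^ j) ∈ leadSpace Z j := by
  induction j with
  | zero => simpa using ha
  | succ j ih => simpa only [pow_succ, pow_mul] using pow_card_mem_leadSpace ih

variable (F) in
theorem pow_card_pow_injective (j : ℕ) : Function.Injective fun x : K => x ^ Fintype.card F ^ j := by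
  have h := (FiniteField.frobeniusAlgHom F K ^ j).toRingHom.injective
  have : ⇑(FiniteField.frobeniusAlgHom F K ^ j) = fun x : K => x ^ Fintype.card F ^ j := by
    rw [AlgHom.coe_pow, FiniteField.coe_frobeniusAlgHom, pow_iterate]
  rw [← this]
  exact h

/-- The Frobenius of a finite field is surjective, so tuples have Frobenius roots. -/
theorem exists_pow_card_pow_eq_fun {ι : Type*} [Finite K] (h : ℕ) (α : ι → K) :
    ∃ γ : ι → K, (fun i => γ i ^ Fintype.card F ^ h) = α := by
  have hs : Function.Surjective fun x : K => x ^ Fintype.card F ^ h :=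
    Finite.surjective_of_injective (pow_card_pow_injective F h)
  choose g hg using hs
  exact ⟨fun i => g (α i), funext fun i => hg (α i)⟩

theorem finrank_frobSpan_succ [FiniteDimensional F K] (Z : Submodule F (ι → K)) (j : ℕ) :
    finrank K (frobSpan Z (j + 1)) + finrank K (leadSpace Z j) =
      finrank K (frobSpan Z j) + Fintype.card ι := by
  have h1 := Submodule.finrank_sup_add_finrank_inf_eq (frobSpan Z j) (combPow Z j).range
  have h2 := LinearMap.finrank_range_add_finrank_ker (K := K) (V := leadSpace Z j)
    ((combPow Z j).domRestrict (leadSpace Z j))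
  have h3 := LinearMap.finrank_range_add_finrank_ker (combPow Z j)
  have h4 : ((combPow Z j).domRestrict (leadSpace Z j)).range =
      frobSpan Z j ⊓ (combPow Z j).range := by
    ext f
    constructor
    · rintro ⟨⟨a, ha⟩, rfl⟩
      exact ⟨ha, a, rfl⟩
    · rintro ⟨hf, a, rfl⟩
      exact ⟨⟨a, hf⟩, rfl⟩
  have h5 : finrank K ((combPow Z j).domRestrict (leadSpace Z j)).ker =
      finrank K (combPow Z j).ker := by
    rw [← Submodule.finrank_map_subtype_eq]
    suffices Submodule.map (leadSpace Z j).subtype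
        ((combPow Z j).domRestrict (leadSpace Z j)).ker = (combPow Z j).ker by rw [this]
    ext a
    simp only [Submodule.mem_map, LinearMap.mem_ker, Subtype.exists]
    constructor
    · rintro ⟨a, ha, h, rfl⟩
      exact h
    · intro h
      exact ⟨a, by rw [mem_leadSpace, h]; exact zero_mem _, h, rfl⟩
  rw [finrank_fintype_fun_eq_card] at h3
  rw [frobSpan_succ]
  rw [h4] at h2
  omega

variable [Fintype K]

/-- If a tuplewise Frobenius power maps `A` into `B`, then `dim A ≤ dim B`. -/
theorem finrank_le_of_pow_card_pow_mem {A B : Submodule K (ι → K)} (j : ℕ)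
    (h : ∀ a ∈ A, (fun i => a i ^ Fintype.card F ^ j) ∈ B) : finrank K A ≤ finrank K B := by
  classical
  have hinj : Function.Injective fun a : A => (⟨_, h a.1 a.2⟩ : B) := fun a b hab =>
    Subtype.ext (funext fun i => pow_card_pow_injective F j (congrFun (congrArg Subtype.val hab) i))
  have hc := Fintype.card_le_of_injective _ hinj
  rw [Module.card_eq_pow_finrank (K := K) (V := A),
    Module.card_eq_pow_finrank (K := K) (V := B)] at hc
  exact (Nat.pow_le_pow_iff_right Fintype.one_lt_card).1 hc

/-- If a tuplewise Frobenius power maps `A` into `B` and `dim B ≤ dim A`, then every element of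
`B` is the Frobenius power of an element of `A`. -/
theorem exists_pow_card_pow_eq {A B : Submodule K (ι → K)} (j : ℕ)
    (h : ∀ a ∈ A, (fun i => a i ^ Fintype.card F ^ j) ∈ B) (hd : finrank K B ≤ finrank K A)
    {b : ι → K} (hb : b ∈ B) : ∃ a ∈ A, ∀ i, a i ^ Fintype.card F ^ j = b i := by
  classical
  have hinj : Function.Injective fun a : A => (⟨_, h a.1 a.2⟩ : B) := fun a b hab =>
    Subtype.ext (funext fun i => pow_card_pow_injective F j (congrFun (congrArg Subtype.val hab) i))
  have hc : Fintype.card A = Fintype.card B := by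
    rw [Module.card_eq_pow_finrank (K := K) (V := A), Module.card_eq_pow_finrank (K := K) (V := B),
      (finrank_le_of_pow_card_pow_mem j h).antisymm hd]
  obtain ⟨a, ha⟩ := ((Fintype.bijective_iff_injective_and_card _).2 ⟨hinj, hc⟩).2 ⟨b, hb⟩
  exact ⟨a.1, a.2, fun i => congrFun (congrArg Subtype.val ha) i⟩

theorem finrank_leadSpace_mono (Z : Submodule F (ι → K)) :
    Monotone fun j => finrank K (leadSpace Z j) :=
  monotone_nat_of_le_succ fun _ => finrank_le_of_pow_card_pow_mem (F := F) 1 fun _ ha => by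
    simpa using pow_card_mem_leadSpace ha

/-- By Dedekind's independence of characters, the powers of the Frobenius span the `F`-linear
endomorphisms of `K`; since every `F`-linear map on `Z` extends to `K^ι`, the functions
`z ↦ z_i ^ (q ^ k)` with `k < [K : F]` span all `F`-linear maps from `Z` to `K`. -/
theorem frobSpan_finrank_eq_top (Z : Submodule F (ι → K)) : frobSpan Z (finrank F K) = ⊤ := by
  classical
  have hspan : Submodule.span K (Set.range fun k : Fin (finrank F K) =>
      (FiniteField.frobeniusAlgHom F K ^ (k : ℕ)).toLinearMap) = ⊤ := by
    refine LinearIndependent.span_eq_top_of_card_eq_finrank' ?_ ?_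
    · exact (linearIndependent_toLinearMap F K K).comp _
        (FiniteField.bijective_frobeniusAlgHom_pow F K).1
    · rw [Fintype.card_fin, Module.finrank_linearMap_self]
  rw [eq_top_iff]
  intro f _
  obtain ⟨g, rfl⟩ := LinearMap.exists_extend f
  have hg : g ∘ₗ Z.subtype = ∑ i, (g ∘ₗ LinearMap.single F (fun _ : ι => K) i) ∘ₗ
      LinearMap.proj i ∘ₗ Z.subtype := by
    ext z
    simp only [LinearMap.comp_apply, LinearMap.sum_apply, LinearMap.proj_apply,
      Submodule.subtype_apply]
    rw [← map_sum]
    congr 1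
    exact (LinearMap.sum_single_apply (fun _ : ι => K) z.1).symm
  rw [hg]
  refine Submodule.sum_mem _ fun i _ => ?_
  have key : ∀ φ : K →ₗ[F] K, φ ∘ₗ LinearMap.proj i ∘ₗ Z.subtype ∈ frobSpan Z (finrank F K) := by
    intro φ
    have hφ : φ ∈ Submodule.span K (Set.range fun k : Fin (finrank F K) =>
      (FiniteField.frobeniusAlgHom F K ^ (k : ℕ)).toLinearMap) := hspan ▸ Submodule.mem_top
    induction hφ using Submodule.span_induction with
    | mem φ h =>
      obtain ⟨k, rfl⟩ := h
      have : (FiniteField.frobeniusAlgHom F K ^ (k : ℕ)).toLinearMap ∘ₗ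
          LinearMap.proj i ∘ₗ Z.subtype = coordPow Z k i := by
        ext z
        simp [AlgHom.coe_pow, FiniteField.coe_frobeniusAlgHom, pow_iterate]
      rw [this]
      exact coordPow_mem_frobSpan Z k.2 i
    | zero => simp
    | add φ ψ _ _ h1 h2 => rw [LinearMap.add_comp]; exact add_mem h1 h2
    | smul c φ _ h => rw [LinearMap.smul_comp]; exact Submodule.smul_mem _ _ h
  exact key _

end FrobeniusSpan

/-! ### Rigidity of the spaces of leading coefficients -/

section Rigidity

variable {F K : Type*} [Field F] [Fintype F] [Field K] [Algebra F K] {m : ℕ}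

theorem finrank_frobSpan_zero (Z : Submodule F (Fin m → K)) : finrank K (frobSpan Z 0) = 0 := by
  rw [frobSpan_zero, finrank_bot]

variable [FiniteDimensional F K]

theorem finrank_frobSpan_succ_fin (Z : Submodule F (Fin m → K)) (j : ℕ) :
    finrank K (frobSpan Z (j + 1)) + finrank K (leadSpace Z j) =
      finrank K (frobSpan Z j) + m := by
  simpa using finrank_frobSpan_succ Z j

variable [Fintype K]

theorem finrank_frobSpan_finrank (Z : Submodule F (Fin m → K)) :
    finrank K (frobSpan Z (finrank F K)) = finrank F Z := by
  rw [frobSpan_finrank_eq_top, finrank_top, Module.finrank_linearMap_self]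

/-- If `dim Z ≥ (m - s) [K : F]` and `[K : F]` is large, then the leading coefficients of the
relations of degree at most `h + 1` among Frobenius powers of the coordinates on `Z` form a
space of dimension at most `s`. Otherwise the growth of `frobSpan Z j` from `j = h + 1` on
would be too slow to reach the dimension of `Z`. -/
theorem finrank_leadSpace_le_of_large {Z : Submodule F (Fin m → K)} {h c s : ℕ} (hcs : c + s = m)
    (hn : (s + 1) * (h + 1) < finrank F K) (hZ : c * finrank F K ≤ finrank F Z) :
    finrank K (leadSpace Z (h + 1)) ≤ s := by
  by_contra! hlt
  have h1 : ∀ j, finrank K (frobSpan Z j) ≤ m * j := by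
    intro j
    induction j with
    | zero => simp [finrank_frobSpan_zero]
    | succ j ih => have := finrank_frobSpan_succ_fin Z j; rw [mul_add]; omega
  have h2 : ∀ k, finrank K (frobSpan Z (h + 1 + k)) + (s + 1) * k ≤ m * (h + 1 + k) := by
    intro k
    induction k with
    | zero => simpa using h1 (h + 1)
    | succ k ih =>
      have := finrank_frobSpan_succ_fin Z (h + 1 + k)
      have hm := finrank_leadSpace_mono Z (show h + 1 ≤ h + 1 + k by omega)
      simp only at hm
      rw [← add_assoc, mul_add, mul_add m]
      omega
  obtain ⟨k, hk⟩ : ∃ k, finrank F K = h + 1 + k := Nat.exists_eq_add_of_le (by nlinarith)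
  have h3 := h2 k
  rw [← hk, finrank_frobSpan_finrank] at h3
  have h4 : (s + 1) * k + (s + 1) * (h + 1) = s * finrank F K + finrank F K := by rw [hk]; ring
  have h5 : m * finrank F K = c * finrank F K + s * finrank F K := by rw [← hcs]; ring
  omega

/-- The case of codimension one: if `frobSpan Z h` has dimension at most `h + 1` and `Z` has
dimension at least `h + 3`, then `frobSpan Z j` still grows at `j = h + 1`. -/
theorem finrank_leadSpace_lt_of_small {Z : Submodule F (Fin m → K)} {h : ℕ} (hh : 2 ≤ h)
    (hn : h + 2 ≤ finrank F K) (hX : finrank K (frobSpan Z h) ≤ h + 1)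
    (hZ : h + 3 ≤ finrank F Z) : finrank K (leadSpace Z (h + 1)) < m := by
  by_contra! hge
  have h1 : ∀ k, finrank K (frobSpan Z (h + 1 + k)) ≤ finrank K (frobSpan Z (h + 1)) := by
    intro k
    induction k with
    | zero => exact le_rfl
    | succ k ih =>
      have := finrank_frobSpan_succ_fin Z (h + 1 + k)
      have hm := finrank_leadSpace_mono Z (show h + 1 ≤ h + 1 + k by omega)
      simp only at hm
      rw [← add_assoc]
      omega
  obtain ⟨k, hk⟩ : ∃ k, finrank F K = h + 1 + k := Nat.exists_eq_add_of_le (by omega)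
  have h2 := h1 k
  rw [← hk, finrank_frobSpan_finrank] at h2
  have h3 := finrank_frobSpan_succ_fin Z h
  -- The last increment is at least two, hence so are the previous ones.
  have h4 : ∀ j ≤ h, 2 * j ≤ finrank K (frobSpan Z j) := by
    intro j hj
    induction j with
    | zero => simp
    | succ j ih =>
      have := finrank_frobSpan_succ_fin Z j
      have hm := finrank_leadSpace_mono Z (show j ≤ h by omega)
      simp only at hm
      have := ih (by omega)
      omega
  have := h4 h le_rfl
  omega

variable [NeZero m]

/-- The extremal case of the dimension count. Let `D` be a space of functions on `Z` of dimension
at most `c (h + 1)` containing the coordinate functions of `V_{A,h}`. If `frobSpan Z j` grows by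
at least `c` at `j = h + 1`, then all inequalities are equalities. Hence the space of relations
among the coordinates on `Z` has dimension `m - c` and is stable under the semilinear map
`a ↦ b`, `α_{i+1} b_i ^ (q ^ h) = a_{i+1} ^ (q ^ (h + 1))`. -/
theorem leadSpace_zero_stable {Z : Submodule F (Fin m → K)} {h c : ℕ} (hh : 0 < h)
    {α : Fin m → K} (hα : ∀ i, α i ≠ 0) {D : Submodule K (Z →ₗ[F] K)}
    (hD : finrank K D ≤ c * (h + 1)) (hX : frobSpan Z h ≤ D)
    (hy : ∀ i, coordPow Z h i + α (i + 1) • coordPow Z (h + 1) (i + 1) ∈ D)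
    (hc : finrank K (leadSpace Z (h + 1)) + c ≤ m) :
    finrank K (leadSpace Z 0) + c = m ∧
      ∀ a ∈ leadSpace Z 0, ∃ b ∈ leadSpace Z 0, ∀ i,
        α (i + 1) * b i ^ Fintype.card F ^ h = a (i + 1) ^ Fintype.card F ^ (h + 1) := by
  have hsup : frobSpan Z (h + 2) ≤ D ⊔ frobSpan Z (h + 1) := by
    refine sup_le le_sup_right ?_
    rintro _ ⟨a, rfl⟩
    rw [combPow_eq]
    refine Submodule.sum_mem _ fun i _ => Submodule.smul_mem _ _ ?_
    have h1 := hy (i - 1)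
    rw [sub_add_cancel] at h1
    have h2 := coordPow_mem_frobSpan Z h.lt_succ_self (i - 1)
    have h3 := Submodule.smul_mem _ (α i)⁻¹ (sub_mem
      (Submodule.mem_sup_left (T := frobSpan Z (h + 1)) h1)
      (Submodule.mem_sup_right (S := D) h2))
    rwa [add_sub_cancel_left, smul_smul, inv_mul_cancel₀ (hα i), one_smul] at h3
  have hd : finrank K (frobSpan Z (h + 2)) + finrank K ↥(D ⊓ frobSpan Z (h + 1)) ≤
      finrank K D + finrank K (frobSpan Z (h + 1)) := by
    rw [← Submodule.finrank_sup_add_finrank_inf_eq D]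
    exact Nat.add_le_add_right (Submodule.finrank_mono hsup) _
  have hle : frobSpan Z h ≤ D ⊓ frobSpan Z (h + 1) := le_inf hX (frobSpan_mono Z h.le_succ)
  have hd1 := Submodule.finrank_mono hle
  have hs := finrank_frobSpan_succ_fin Z (h + 1)
  rw [mul_add] at hD
  have hd2 : finrank K ↥(D ⊓ frobSpan Z (h + 1)) ≤ c * h := by
    rw [show h + 1 + 1 = h + 2 from rfl] at hs
    omega
  have hmono := finrank_leadSpace_mono Z
  have hgrow : ∀ j, j < h → finrank K (frobSpan Z 1) + c * j ≤ finrank K (frobSpan Z (j + 1)) := by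
    intro j hj
    induction j with
    | zero => simp
    | succ j ih =>
      have h1 := ih (by omega)
      have h2 := finrank_frobSpan_succ_fin Z (j + 1)
      have h3 := hmono (show j + 1 ≤ h + 1 by omega)
      simp only at h3
      rw [mul_add]
      omega
  have h0 := finrank_frobSpan_succ_fin Z 0
  rw [finrank_frobSpan_zero] at h0
  obtain ⟨g, rfl⟩ : ∃ g, h = g + 1 := Nat.exists_eq_add_of_le' hh
  have hg := hgrow g g.lt_succ_self
  have ha0 : finrank K (leadSpace Z 0) + c = m := by
    have h3 := hmono (show 0 ≤ g + 1 + 1 by omega)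
    simp only at h3
    rw [mul_add] at hd2
    rw [zero_add] at h0
    omega
  have hah : finrank K (leadSpace Z (g + 1)) ≤ finrank K (leadSpace Z 0) := by
    have h3 := hmono (show g + 1 ≤ g + 1 + 1 by omega)
    simp only at h3
    omega
  have heq : frobSpan Z (g + 1) = D ⊓ frobSpan Z (g + 1 + 1) := by
    refine Submodule.eq_of_le_of_finrank_le hle (hd2.trans ?_)
    rw [mul_add]
    rw [zero_add] at h0
    omega
  refine ⟨ha0, fun a ha => ?_⟩
  -- Reduce the combination of the coordinate functions that cancels the top Frobenius power.
  have htop : combPow Z (g + 1 + 1) (fun i => a i ^ Fintype.card F ^ (g + 1 + 1)) = 0 := by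
    have h1 : combPow Z 0 a = 0 := by simpa [mem_leadSpace, frobSpan_zero] using ha
    have h2 : ∀ j, combPow Z j (fun i => a i ^ Fintype.card F ^ j) = 0 := by
      intro j
      induction j with
      | zero => simpa using h1
      | succ j ih =>
        have := frobTwist_combPow Z j fun i => a i ^ Fintype.card F ^ j
        rw [ih] at this
        simp only [pow_succ, pow_mul]
        rw [← this]
        simp [frobTwist]
    exact h2 _
  set b : Fin m → K := fun i => a (i + 1) ^ Fintype.card F ^ (g + 1 + 1) / α (i + 1) with hb
  have hbD : combPow Z (g + 1) b ∈ D := by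
    have h1 : combPow Z (g + 1) b =
        ∑ i, b i • (coordPow Z (g + 1) i + α (i + 1) • coordPow Z (g + 1 + 1) (i + 1)) := by
      simp only [smul_add, Finset.sum_add_distrib, smul_smul]
      rw [← combPow_eq, left_eq_add, ← htop, combPow_eq]
      refine (Equiv.sum_comp (Equiv.addRight (1 : Fin m)) _).symm.trans
        (Finset.sum_congr rfl fun i _ => ?_) |>.symm
      rw [hb]
      simp only [Equiv.coe_addRight]
      rw [div_mul_cancel₀ _ (hα _)]
    rw [h1]
    exact D.sum_mem fun i _ => D.smul_mem _ (hy i)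
  have hbl : b ∈ leadSpace Z (g + 1) := by
    rw [mem_leadSpace, heq]
    exact ⟨hbD, combPow_mem_frobSpan Z (g + 1).lt_succ_self b⟩
  obtain ⟨x, hx, hxb⟩ := exists_pow_card_pow_eq (F := F) (g + 1)
    (fun a ha => pow_card_pow_mem_leadSpace ha (g + 1)) hah hbl
  refine ⟨x, hx, fun i => ?_⟩
  rw [hxb, hb]
  exact mul_div_cancel₀ _ (hα _)

end Rigidity

/-! ### Subspaces stable under a weighted cyclic shift -/

section Shift

open scoped Fin.NatCast Fin.CommRing

variable {F K : Type*} [Fintype F] [Field K] {m : ℕ} [NeZero m]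

/-- The `K`-subspace `T` of `K^m` is stable under the Frobenius-semilinear weighted cyclic shift
`a ↦ b` with `γ_{i+1} b_i = a_{i+1} ^ q`. -/
def IsShiftStable (F : Type*) [Fintype F] {K : Type*} [Field K] (γ : Fin m → K)
    (T : Submodule K (Fin m → K)) : Prop :=
  ∀ a ∈ T, ∃ b ∈ T, ∀ i, γ (i + 1) * b i = a (i + 1) ^ Fintype.card F

theorem cyclicProd_pow (γ : Fin m → K) (h : ℕ) (i : Fin m) :
    cyclicProd F (fun i => γ i ^ Fintype.card F ^ h) i =
      cyclicProd F γ i ^ Fintype.card F ^ h := by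
  rw [cyclicProd, cyclicProd, ← Finset.prod_pow]
  refine Finset.prod_congr rfl fun k _ => ?_
  rw [← pow_mul, ← pow_mul, mul_comm]

/-- The `k`-fold iterate of the weighted shift, in terms of coordinates. -/
theorem IsShiftStable.exists_iterate {γ : Fin m → K} {T : Submodule K (Fin m → K)}
    (hT : IsShiftStable F γ T) {a : Fin m → K} (ha : a ∈ T) (k : ℕ) :
    ∃ b ∈ T, ∀ i, (∏ l ∈ Finset.range k, γ (i + 1 + (l : Fin m)) ^ Fintype.card F ^ l) * b i =
      a (i + (k : Fin m)) ^ Fintype.card F ^ k := by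
  induction k with
  | zero => exact ⟨a, ha, fun i => by simp⟩
  | succ k ih =>
    obtain ⟨b, hb, hbe⟩ := ih
    obtain ⟨x, hx, hxe⟩ := hT b hb
    refine ⟨x, hx, fun i => ?_⟩
    have h1 := congrArg (· ^ Fintype.card F) (hbe (i + 1))
    simp only [mul_pow, ← hxe, ← pow_mul, ← pow_succ, ← Finset.prod_pow] at h1
    rw [Finset.prod_range_succ']
    push_cast
    rw [show i + (↑k + 1) = i + 1 + (k : Fin m) by abel, ← h1]
    simp only [pow_zero, pow_one, add_zero]
    rw [mul_assoc]
    congr 1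
    refine Finset.prod_congr rfl fun l _ => ?_
    rw [show i + 1 + ((l : Fin m) + 1) = i + 1 + 1 + (l : Fin m) by abel]

variable [Field F] [Algebra F K]

/-- The set `𝒜` is stable under taking Frobenius roots. -/
theorem mem_setA_of_pow {γ : Fin m → K} {h : ℕ}
    (hγ : (fun i => γ i ^ Fintype.card F ^ h) ∈ setA F K m) : γ ∈ setA F K m := by
  refine ⟨fun i hi => hγ.1 i (by simp [hi]), ?_⟩
  rintro ⟨y, hy⟩
  exact hγ.2 ⟨y ^ Fintype.card F ^ h, by rw [cyclicProd_pow, ← hy, ← pow_mul, ← pow_mul, mul_comm]⟩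

/-- The set `ℬ` is stable under taking Frobenius roots. -/
theorem mem_setB_of_pow {γ : Fin m → K} {h : ℕ}
    (hγ : (fun i => γ i ^ Fintype.card F ^ h) ∈ setB F K m) : γ ∈ setB F K m := by
  refine ⟨mem_setA_of_pow hγ.1, fun δ hδ => ?_⟩
  rintro ⟨y, hy⟩
  refine hγ.2 δ hδ ⟨y ^ Fintype.card F ^ h, ?_⟩
  rw [cyclicProd_pow, cyclicProd_pow, ← div_pow, ← hy, ← pow_mul, ← pow_mul, mul_comm]

/-- Going once around the cycle `a_{i+1} ^ q = μ γ_{i+1} a_i`, the product `Π_1` telescopes to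
`a_0 ^ (q ^ m - 1)` up to a power of `μ`. -/
theorem notMem_setA_of_cycle {γ a : Fin m → K} {μ : K} (hμ : μ ≠ 0) (ha : ∀ i, a i ≠ 0)
    (h : ∀ i, a (i + 1) ^ Fintype.card F = μ * γ (i + 1) * a i) : γ ∉ setA F K m := by
  intro hγ
  refine hγ.2 ⟨a 0 ^ (Fintype.card F - 1) / μ, ?_⟩
  have key : ∀ M : ℕ, (∏ k ∈ Finset.range M, γ ((k + 1 : ℕ) : Fin m) ^ Fintype.card F ^ k) * a 0 *
      μ ^ (∑ k ∈ Finset.range M, Fintype.card F ^ k) =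
        a (M : Fin m) ^ Fintype.card F ^ M := by
    intro M
    induction M with
    | zero => simp
    | succ M ih =>
      rw [Finset.prod_range_succ, Finset.sum_range_succ, pow_add]
      have h1 := h (M : Fin m)
      have h2 : ((M + 1 : ℕ) : Fin m) = (M : Fin m) + 1 := by push_cast; rfl
      rw [h2, pow_succ' _ M, pow_mul, h1, mul_pow, mul_pow, ← ih]
      ring
  have hm := key m
  have hprod : cyclicProd F γ 0 =
      ∏ k ∈ Finset.range m, γ ((k + 1 : ℕ) : Fin m) ^ Fintype.card F ^ k := by
    rw [← Fin.prod_univ_eq_prod_range (fun k => γ ((k + 1 : ℕ) : Fin m) ^ Fintype.card F ^ k)]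
    refine Finset.prod_congr rfl fun k _ => ?_
    congr 2
    push_cast
    rw [zero_add, add_comm]
  rw [← hprod, Fin.natCast_self] at hm
  obtain ⟨x, hx⟩ : ∃ x, Fintype.card F = x + 1 := Nat.exists_eq_add_of_le' Fintype.card_pos
  have hgeom : (∑ k ∈ Finset.range m, Fintype.card F ^ k) * x + 1 = Fintype.card F ^ m := by
    rw [hx]; exact geom_sum_mul_add x m
  rw [div_pow, div_eq_iff (pow_ne_zero _ hμ), ← mul_left_inj' (ha 0),
    mul_right_comm (cyclicProd F γ 0), hm, ← hgeom, pow_succ]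
  congr 1
  rw [← pow_mul, hx, Nat.add_sub_cancel, mul_comm]

/-- Induction around the cycle, starting anywhere. -/
theorem forall_of_forall_add_one {p : Fin m → Prop} {i : Fin m} (hi : p i)
    (h : ∀ i, p i → p (i + 1)) (j : Fin m) : p j := by
  have key : ∀ k : ℕ, p (i + (k : Fin m)) := by
    intro k
    induction k with
    | zero => simpa using hi
    | succ k ih =>
      have := h _ ih
      rw [add_assoc] at this
      push_cast
      exact this
  have := key (j - i).val
  rwa [Fin.cast_val_eq_self, add_sub_cancel] at this

theorem IsShiftStable.notMem_setA_of_finrank_eq_one {γ : Fin m → K}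
    {T : Submodule K (Fin m → K)} (hT : IsShiftStable F γ T) (h1 : finrank K T = 1) :
    γ ∉ setA F K m := by
  intro hγ
  obtain ⟨⟨a, haT⟩, ha0, hspan⟩ := finrank_eq_one_iff'.1 h1
  obtain ⟨b, hbT, hb⟩ := hT a haT
  obtain ⟨μ, hμ⟩ := hspan ⟨b, hbT⟩
  have hμb : ∀ i, b i = μ * a i := fun i => (congrFun (congrArg Subtype.val hμ) i).symm
  have hrel : ∀ i, a (i + 1) ^ Fintype.card F = μ * γ (i + 1) * a i := fun i => by
    rw [← hb, hμb]; ring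
  obtain ⟨i, hi⟩ : ∃ i, a i ≠ 0 := by
    by_contra! hall
    exact ha0 (Subtype.ext (funext hall))
  have hμ0 : μ ≠ 0 := by
    rintro rfl
    have := hrel (i - 1)
    rw [sub_add_cancel, zero_mul, zero_mul] at this
    exact hi (eq_zero_of_pow_eq_zero this)
  refine notMem_setA_of_cycle hμ0 (fun j => ?_) hrel hγ
  refine forall_of_forall_add_one (p := fun i => a i ≠ 0) hi (fun i hi h0 => ?_) j
  have := hrel i
  rw [h0, zero_pow Fintype.card_ne_zero] at this
  exact mul_ne_zero (mul_ne_zero hμ0 (hγ.1 _)) hi this.symm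

/-- The coefficients of an equation of a stable hyperplane satisfy the same kind of cyclic
relation as a generator of a stable line, up to inversion. -/
theorem IsShiftStable.notMem_setA_of_finrank_add_one {γ : Fin m → K}
    {T : Submodule K (Fin m → K)} (hT : IsShiftStable F γ T) (h1 : finrank K T + 1 = m) :
    γ ∉ setA F K m := by
  intro hγ
  have hlt : T < ⊤ := by
    refine lt_top_iff_ne_top.2 fun h => ?_
    rw [h, finrank_top, finrank_fin_fun] at h1
    omega
  obtain ⟨f, hf0, hTf⟩ := T.exists_le_ker_of_lt_top hlt
  have hT' : T = f.ker := by
    refine Submodule.eq_of_le_of_finrank_le hTf ?_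
    have := Module.Dual.finrank_ker_add_one_of_ne_zero hf0
    rw [finrank_fin_fun] at this
    omega
  set c : Fin m → K := fun i => f (Pi.single i 1) with hc
  have hfc : ∀ a, f a = ∑ i, a i * c i := fun a => by
    rw [LinearMap.pi_apply_eq_sum_univ f a]
    refine Finset.sum_congr rfl fun i _ => ?_
    rw [smul_eq_mul, hc]
    congr 2
    ext j
    simp [Pi.single_apply, eq_comm]
  have hsingle : ∀ i x, f (Pi.single i x) = x * c i := fun i x => by
    rw [hfc, Finset.sum_eq_single i] <;> simp +contextual
  obtain ⟨i₀, hi₀⟩ : ∃ i, c i ≠ 0 := by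
    by_contra! hall
    exact hf0 (LinearMap.ext fun a => by simp [hfc, hall])
  -- The vector supported on two coordinates in the kernel of `f` is moved into the kernel.
  have hpair : ∀ i j, i ≠ j → c (i - 1) * c j ^ Fintype.card F * γ j =
      c (j - 1) * c i ^ Fintype.card F * γ i := by
    intro i j hij
    have hmem : Pi.single i (c j) + Pi.single j (-c i) ∈ T := by
      rw [hT', LinearMap.mem_ker, map_add, hsingle, hsingle]; ring
    obtain ⟨b, hb, hbe⟩ := hT _ hmem
    rw [hT', LinearMap.mem_ker] at hb
    have hbi : γ i * b (i - 1) = c j ^ Fintype.card F := by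
      simpa [Pi.single_apply, hij] using hbe (i - 1)
    have hbj : γ j * b (j - 1) = (-c i) ^ Fintype.card F := by
      simpa [Pi.single_apply, hij.symm] using hbe (j - 1)
    have hneg : (-c i) ^ Fintype.card F = - c i ^ Fintype.card F := by
      simpa using map_neg (FiniteField.frobeniusAlgHom F K) (c i)
    have hbk : ∀ k, k ≠ i - 1 → k ≠ j - 1 → b k = 0 := by
      intro k hki hkj
      have := hbe k
      have e1 : k + 1 ≠ i := fun h => hki (by rw [← h, add_sub_cancel_right])
      have e2 : k + 1 ≠ j := fun h => hkj (by rw [← h, add_sub_cancel_right])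
      simp only [Pi.add_apply, Pi.single_eq_of_ne e1, Pi.single_eq_of_ne e2, add_zero,
        zero_pow Fintype.card_ne_zero] at this
      exact (mul_eq_zero.1 this).resolve_left (hγ.1 _)
    have hij' : i - 1 ≠ j - 1 := fun h => hij (sub_left_injective h)
    have hsum : b (i - 1) * c (i - 1) + b (j - 1) * c (j - 1) = 0 := by
      rw [← hb, hfc, Finset.sum_eq_add (i - 1) (j - 1) hij']
      · rintro k - ⟨h1, h2⟩
        rw [hbk k h1 h2, zero_mul]
      · simp
      · simp
    rw [← hbi]
    rw [hneg] at hbj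
    rw [← neg_eq_iff_eq_neg.2 hbj]
    linear_combination (γ i * γ j) * hsum
  have hrel' : ∀ i, c (i - 1) * c i₀ ^ Fintype.card F * γ i₀ =
      c (i₀ - 1) * c i ^ Fintype.card F * γ i := by
    intro i
    rcases eq_or_ne i i₀ with rfl | hne
    · rfl
    · exact hpair i i₀ hne
  have hnz : c i₀ ^ Fintype.card F * γ i₀ ≠ 0 := mul_ne_zero (pow_ne_zero _ hi₀) (hγ.1 _)
  have hν : c (i₀ - 1) ≠ 0 := by
    intro h0
    have := hrel' (i₀ + 1)
    rw [h0, zero_mul, zero_mul, add_sub_cancel_right, mul_assoc] at this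
    exact mul_ne_zero hi₀ hnz this
  have hcnz : ∀ j, c j ≠ 0 := by
    refine forall_of_forall_add_one (p := fun i => c i ≠ 0) hi₀ fun i hi h0 => ?_
    have := hrel' (i + 1)
    rw [h0, zero_pow Fintype.card_ne_zero, mul_zero, zero_mul, add_sub_cancel_right,
      mul_assoc] at this
    exact mul_ne_zero hi hnz this
  refine notMem_setA_of_cycle (γ := γ) (a := fun i => (c i)⁻¹)
    (μ := c (i₀ - 1) / (c i₀ ^ Fintype.card F * γ i₀))
    (div_ne_zero hν hnz) (fun i => inv_ne_zero (hcnz i)) (fun i => ?_) hγ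
  have h2 := hrel' (i + 1)
  rw [add_sub_cancel_right] at h2
  have h3 := hcnz i
  have h4 := hcnz (i + 1)
  have h5 := hγ.1 i₀
  simp only [inv_pow]
  field_simp
  linear_combination h2

/-- A stable subspace contains, with a nonzero vector, one of minimal support. Going once around
the cycle multiplies the coordinates by twists of the `Π_i`, which are inequivalent for tuples in
`ℬ`; so a minimal support is a single coordinate, and shifting gives all coordinates. -/
theorem IsShiftStable.eq_top_of_mem_setB {γ : Fin m → K} {T : Submodule K (Fin m → K)}
    (hT : IsShiftStable F γ T) (hT0 : T ≠ ⊥) (hγ : γ ∈ setB F K m) : T = ⊤ := by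
  classical
  have hprod : ∀ (k : ℕ) (i : Fin m),
      (∏ l ∈ Finset.range k, γ (i + 1 + (l : Fin m)) ^ Fintype.card F ^ l) ≠ 0 := fun k i =>
    Finset.prod_ne_zero_iff.2 fun l _ => pow_ne_zero _ (hγ.1.1 _)
  have hcyc : ∀ i, cyclicProd F γ i =
      ∏ l ∈ Finset.range m, γ (i + 1 + (l : Fin m)) ^ Fintype.card F ^ l := by
    intro i
    rw [← Fin.prod_univ_eq_prod_range
      (fun l => γ (i + 1 + (l : Fin m)) ^ Fintype.card F ^ l), cyclicProd]
    simp only [Fin.cast_val_eq_self]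
  let supp : (Fin m → K) → Finset (Fin m) := fun a => {i | a i ≠ 0}
  have hiter : ∀ a ∈ T, ∀ j : Fin m, ∃ b ∈ T, ∀ i, b i ≠ 0 ↔ a (i + j) ≠ 0 := by
    intro a ha j
    obtain ⟨b, hb, hbe⟩ := hT.exists_iterate ha j.val
    refine ⟨b, hb, fun i => ?_⟩
    have h1 := hbe i
    rw [Fin.cast_val_eq_self] at h1
    rw [← (pow_ne_zero_iff (a := a (i + j)) (pow_ne_zero j.val (Fintype.card_ne_zero (α := F)))), ← h1]
    simp [hprod]
  obtain ⟨x, ⟨hxT, hx0⟩, hmin⟩ := exists_minimalFor_of_wellFoundedLT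
    (fun a : Fin m → K => a ∈ T ∧ a ≠ 0) (fun a => (supp a).card) ((Submodule.ne_bot_iff _).1 hT0)
  obtain ⟨j, hj⟩ : ∃ j, x j ≠ 0 := by
    by_contra! hall
    exact hx0 (funext hall)
  obtain ⟨y, hyT, hy⟩ := hiter x hxT (j - 1)
  have hy1 : y 1 ≠ 0 := (hy 1).2 (by rwa [add_sub_cancel])
  have hcard : (supp y).card ≤ (supp x).card := by
    refine Finset.card_le_card_of_injOn (· + (j - 1)) (fun i hi => ?_)
      (fun a _ b _ h => add_left_injective _ h)
    simp only [supp, Finset.coe_filter, Finset.mem_univ, true_and, Set.mem_ofPred_eq] at hi ⊢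
    exact (hy i).1 hi
  obtain ⟨z, hzT, hz⟩ := hT.exists_iterate hyT m
  simp only [← hcyc, Fin.natCast_self, add_zero] at hz
  have hcp : ∀ i, cyclicProd F γ i ≠ 0 := fun i => by rw [hcyc]; exact hprod m i
  -- Subtract a multiple of `y` from its image to remove a coordinate from the support.
  have hzero : z - (z 1 / y 1) • y = 0 := by
    by_contra hne
    have h1 := hmin ⟨T.sub_mem hzT (T.smul_mem _ hyT), hne⟩
    have h2 : (supp (z - (z 1 / y 1) • y)).card < (supp y).card := by
      refine Finset.card_lt_card ⟨fun i hi => ?_, fun hsub => ?_⟩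
      · simp only [supp, Finset.mem_filter, Finset.mem_univ, true_and, Pi.sub_apply,
          Pi.smul_apply, smul_eq_mul] at hi ⊢
        intro h0
        refine hi ?_
        have := hz i
        rw [h0, zero_pow (pow_ne_zero _ Fintype.card_ne_zero), mul_eq_zero] at this
        rw [this.resolve_left (hcp i), h0, mul_zero, sub_zero]
      · have := hsub (show (1 : Fin m) ∈ supp y by simp [supp, hy1])
        simp [supp, hy1] at this
    have h3 := h1 (by simp only; omega)
    simp only at h3
    omega
  have hysupp : ∀ i, i ≠ 1 → y i = 0 := by
    intro i hi
    by_contra hyi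
    refine hγ.2 (i - 1) (sub_ne_zero.2 hi) ⟨y i / y 1, ?_⟩
    rw [sub_add_cancel]
    have h1 := hz i
    have h2 := hz 1
    have h3 : z i = z 1 / y 1 * y i := sub_eq_zero.1 (congrFun hzero i)
    rw [h3] at h1
    have hq : Fintype.card F ^ m = (Fintype.card F ^ m - 1) + 1 :=
      (Nat.sub_add_cancel (Nat.one_le_pow _ _ Fintype.card_pos)).symm
    rw [hq, pow_succ] at h1 h2
    have h4 : z 1 ≠ 0 := by
      intro h0
      rw [h0, mul_zero] at h2
      exact mul_ne_zero (pow_ne_zero _ hy1) hy1 h2.symm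
    have h5 : cyclicProd F γ i * (z 1 / y 1) = y i ^ (Fintype.card F ^ m - 1) :=
      mul_right_cancel₀ hyi (by rw [← h1]; ring)
    have h6 : cyclicProd F γ 1 * (z 1 / y 1) = y 1 ^ (Fintype.card F ^ m - 1) :=
      mul_right_cancel₀ hy1 (by rw [← h2]; field_simp)
    rw [div_pow, ← h5, ← h6, mul_div_mul_right _ _ (div_ne_zero h4 hy1)]
  rw [eq_top_iff]
  intro a _
  rw [pi_eq_sum_univ' a]
  refine T.sum_mem fun i _ => ?_
  obtain ⟨w, hwT, hw⟩ := hiter y hyT (1 - i)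
  have hwi : w i ≠ 0 := (hw i).2 (by rwa [add_sub_cancel])
  have hwk : ∀ k, k ≠ i → w k = 0 := by
    intro k hk
    by_contra h0
    refine (hw k).1 h0 (hysupp _ fun h => hk ?_)
    have := congrArg (· - (1 - i)) h
    simpa using this
  convert T.smul_mem (a i / w i) hwT using 1
  ext k
  rcases eq_or_ne k i with rfl | hk
  · simp [hwi]
  · simp [hwk k hk, hk.symm]

end Shift

/-! ### Generalized weights of associated codes -/

section Weights

variable {F K V V' : Type*} [Field F] [Field K] [Algebra F K]
  [AddCommGroup V] [Module F V] [Module K V] [IsScalarTower F K V]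
  [AddCommGroup V'] [Module F V'] [Module K V'] [IsScalarTower F K V']

theorem wt_map_equiv (e : V ≃ₗ[K] V') (U : Submodule F V) (H : Submodule K V) :
    wt K (U.map ((e.restrictScalars F : V ≃ₗ[F] V') : V →ₗ[F] V')) (H.map (e : V →ₗ[K] V')) =
      wt K U H := by
  have h : (H.map (e : V →ₗ[K] V')).restrictScalars F =
      (H.restrictScalars F).map ((e.restrictScalars F : V ≃ₗ[F] V') : V →ₗ[F] V') := rfl
  rw [wt, wt, h, ← Submodule.map_inf _ (e.restrictScalars F).injective]
  exact LinearEquiv.finrank_map_eq (e.restrictScalars F) _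

theorem systemGenWeight_map_equiv (e : V ≃ₗ[K] V') (U : Submodule F V) (ρ : ℕ) :
    systemGenWeight K (U.map ((e.restrictScalars F : V ≃ₗ[F] V') : V →ₗ[F] V')) ρ =
      systemGenWeight K U ρ := by
  rw [systemGenWeight, systemGenWeight, LinearEquiv.finrank_map_eq (e.restrictScalars F)]
  congr 2
  ext w
  constructor
  · rintro ⟨H, hH, rfl⟩
    refine ⟨H.map (e.symm : V' →ₗ[K] V), ?_, ?_⟩
    · rw [LinearEquiv.finrank_map_eq, hH, e.finrank_eq]
    · rw [← wt_map_equiv e, ← Submodule.map_comp]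
      simp
  · rintro ⟨H, hH, rfl⟩
    refine ⟨H.map (e : V →ₗ[K] V'), ?_, (wt_map_equiv e U H).symm⟩
    rw [LinearEquiv.finrank_map_eq, hH, e.finrank_eq]

variable {ι : Type*} {t : ℕ}

/-- Every system associated with `C` is the image, under a `K`-linear isomorphism, of one that
depends only on `C`: the `F`-span of the coordinate functionals in the dual space of `C`. -/
theorem IsAssociated.exists_equiv {U : Submodule F (ι → K)} {C : Submodule K (Fin t → K)}
    (h : IsAssociated U C) : ∃ e : Dual K C ≃ₗ[K] (ι → K),
      U = (Submodule.span F (Set.range fun j : Fin t =>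
        ((LinearMap.proj j : (Fin t → K) →ₗ[K] K) ∘ₗ C.subtype : Dual K C))).map
        ((e.restrictScalars F : Dual K C ≃ₗ[F] (ι → K)) : Dual K C →ₗ[F] (ι → K)) := by
  obtain ⟨G, hli, rfl, -, rfl⟩ := h
  refine ⟨((Basis.span hli).constr K).symm, ?_⟩
  rw [Submodule.map_span, ← Set.range_comp]
  congr 2
  ext j i
  change G i j = ((Basis.span hli) i : Fin t → K) j
  rw [Basis.span_apply]
  rfl

theorem IsAssociated.systemGenWeight_eq {κ : Type*} {U : Submodule F (ι → K)}
    {U' : Submodule F (κ → K)} {C : Submodule K (Fin t → K)} (h : IsAssociated U C)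
    (h' : IsAssociated U' C) (ρ : ℕ) : systemGenWeight K U ρ = systemGenWeight K U' ρ := by
  obtain ⟨e, rfl⟩ := h.exists_equiv
  obtain ⟨e', rfl⟩ := h'.exists_equiv
  rw [systemGenWeight_map_equiv, systemGenWeight_map_equiv]

theorem IsAssociated.reindex {κ : Type*} (e : κ ≃ ι) {U : Submodule F (ι → K)}
    {C : Submodule K (Fin t → K)} (h : IsAssociated U C) :
    ∃ U' : Submodule F (κ → K), IsAssociated U' C := by
  obtain ⟨G, hli, hC, hcol, -⟩ := h
  refine ⟨_, G.submatrix e id, hli.comp _ e.injective, ?_, ?_, rfl⟩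
  · rw [← hC, ← e.surjective.range_comp G.row]
    rfl
  · exact hcol.map' (LinearEquiv.funCongrLeft F K e : (ι → K) →ₗ[F] (κ → K))
      (LinearEquiv.ker _)

/-- The generalized weights of a code are those of any associated system. -/
theorem IsAssociated.codeGenWeight_eq [Finite ι] {U : Submodule F (ι → K)}
    {C : Submodule K (Fin t → K)} (h : IsAssociated U C) (ρ : ℕ) :
    codeGenWeight F C ρ = systemGenWeight K U ρ := by
  obtain ⟨k, ⟨e⟩⟩ := Finite.exists_equiv_fin ι
  obtain ⟨U', hU'⟩ := h.reindex e.symm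
  have : {d | ∃ (k : ℕ) (U : Submodule F (Fin k → K)),
      IsAssociated U C ∧ d = systemGenWeight K U ρ} = {systemGenWeight K U ρ} := by
    ext d
    constructor
    · rintro ⟨k, U₁, h₁, rfl⟩
      exact h₁.systemGenWeight_eq h ρ
    · rintro rfl
      exact ⟨k, U', hU', h.systemGenWeight_eq hU' ρ⟩
  rw [codeGenWeight, this, csInf_singleton]

end Weights

/-! ### Direct sums of scattered subspaces -/

section DirectSum

variable {F K V : Type*} [Field F] [Field K] [Algebra F K] [FiniteDimensional F K]
  [AddCommGroup V] [Module F V] [Module K V] [IsScalarTower F K V]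

/-- An `h`-scattered subspace of an `(h + 1)`-dimensional space has dimension at most `[K : F]`.
As in the Singleton bound, restricting functionals to `[K : F] + 1` independent vectors of `U` and
keeping `h` of the `F`-coordinates of the values is injective on the dual space. -/
theorem IsHScattered.finrank_le {h : ℕ} {U : Submodule F V} (hU : IsHScattered K h U)
    (hV : finrank K V = h + 1) (hn : h < finrank F K) : finrank F U ≤ finrank F K := by
  have : FiniteDimensional K V := Module.finite_of_finrank_pos (by omega)
  have : FiniteDimensional F V := FiniteDimensional.trans F K V
  by_contra! hlt
  set n := finrank F K with hn'
  let v : Fin (n + 1) → V := fun i => (finBasis F U (Fin.castLE hlt i)).1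
  have hv : LinearIndependent F v :=
    ((finBasis F U).linearIndependent.comp _ (Fin.castLE_injective hlt)).map' U.subtype
      U.ker_subtype
  have hvU : ∀ i, v i ∈ U := fun i => (finBasis F U (Fin.castLE hlt i)).2
  let π : K →ₗ[F] (Fin h → F) :=
    LinearMap.funLeft F F (Fin.castLE hn.le) ∘ₗ (finBasis F K).equivFun.toLinearMap
  have hπ : Function.Surjective π :=
    (LinearMap.funLeft_surjective_of_injective F F _ (Fin.castLE_injective hn.le)).comp
      (finBasis F K).equivFun.surjective
  let Φ : Dual K V →ₗ[F] (Fin (n + 1) → Fin h → F) :=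
    LinearMap.pi fun i => π ∘ₗ (Dual.eval K V (v i)).restrictScalars F
  have hΦ : Function.Injective Φ := by
    rw [injective_iff_map_eq_zero]
    intro f hf
    by_contra hf0
    let g : (Fin (n + 1) → F) →ₗ[F] K := f.restrictScalars F ∘ₗ Fintype.linearCombination F v
    have hgπ : g.range ≤ π.ker := by
      rintro _ ⟨c, rfl⟩
      rw [LinearMap.mem_ker]
      have hfi : ∀ i, π (f (v i)) = 0 := fun i => congrFun hf i
      simp [g, Fintype.linearCombination_apply, map_sum, hfi]
    have h1 := Submodule.finrank_mono hgπ
    have h2 := LinearMap.finrank_range_add_finrank_ker π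
    rw [LinearMap.range_eq_top.2 hπ, finrank_top, finrank_fin_fun] at h2
    have h3 := LinearMap.finrank_range_add_finrank_ker g
    rw [finrank_fin_fun] at h3
    have hker : finrank F g.ker ≤ wt K U f.ker := by
      have hinj : Function.Injective (Fintype.linearCombination F v) :=
        hv.fintypeLinearCombination_injective
      rw [LinearEquiv.finrank_eq (Submodule.equivMapOfInjective _ hinj g.ker)]
      refine Submodule.finrank_mono ?_
      rintro _ ⟨c, hc, rfl⟩
      refine ⟨?_, hc⟩
      rw [Fintype.linearCombination_apply]
      exact U.sum_mem fun i _ => U.smul_mem _ (hvU i)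
    have h4 := hU.wt_le f.ker (by
      have := Module.Dual.finrank_ker_add_one_of_ne_zero hf0
      omega)
    omega
  have h1 := LinearMap.finrank_le_finrank_of_injective hΦ
  rw [Module.finrank_pi_fintype, Finset.sum_const, Finset.card_univ, Fintype.card_fin,
    finrank_fin_fun, smul_eq_mul, ← Module.finrank_mul_finrank F K (Dual K V),
    Subspace.dual_finrank_eq, hV, ← hn'] at h1
  nlinarith

theorem finrank_finset_sup_le {ι k M : Type*} [Field k] [AddCommGroup M] [Module k M]
    [FiniteDimensional k M] (S : Finset ι) (W : ι → Submodule k M) :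
    finrank k ↥(S.sup W) ≤ ∑ i ∈ S, finrank k (W i) := by
  classical
  induction S using Finset.induction_on with
  | empty => simp
  | insert i S hi ih =>
    rw [Finset.sup_insert, Finset.sum_insert hi]
    exact (Submodule.finrank_add_le_finrank_add_finrank _ _).trans (Nat.add_le_add_left ih _)

/-- A direct sum of scattered subspaces has small generalized weights, because the sum of all but
`s` of the ambient summands has a large weight. -/
theorem IsDirectSumOfMaximumHScattered.systemGenWeight_le {h m s : ℕ} {U : Submodule F V}
    (hU : IsDirectSumOfMaximumHScattered K h m U) (hV : finrank K V = m * (h + 1))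
    [FiniteDimensional K V] (hn : h < finrank F K) (hs : s ≤ m) :
    systemGenWeight K U (s * (h + 1)) ≤ s * finrank F K := by
  have : FiniteDimensional F V := FiniteDimensional.trans F K V
  obtain ⟨W, hW, hWd, U', hU', rfl⟩ := hU
  obtain ⟨S, -, hS⟩ := Finset.exists_subset_card_eq
    (s := (Finset.univ : Finset (Fin m))) (n := s) (by simpa using hs)
  have hSc : Sᶜ.card + s = m := by
    rw [← hS, Finset.card_compl_add_card, Fintype.card_fin]
  set U₁ : Fin m → Submodule F V := fun i => (U' i).map ((W i).subtype.restrictScalars F)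
  set H : Submodule K V := Sᶜ.sup W
  have hH : finrank K H + s * (h + 1) = finrank K V := by
    have h1 : finrank K H ≤ Sᶜ.card * (h + 1) := by
      simpa [hWd] using finrank_finset_sup_le Sᶜ W
    have h2 : finrank K ↥(S.sup W) ≤ s * (h + 1) := by
      simpa [hWd, hS] using finrank_finset_sup_le S W
    have h3 : H ⊔ S.sup W = ⊤ := by
      rw [← Finset.sup_union, Finset.union_comm, Finset.union_compl, Finset.sup_univ_eq_iSup,
        hW.submodule_iSup_eq_top]
    have h4 := Submodule.finrank_add_le_finrank_add_finrank H (S.sup W)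
    rw [h3, finrank_top] at h4
    have h5 : Sᶜ.card * (h + 1) + s * (h + 1) = finrank K V := by rw [hV, ← add_mul, hSc]
    omega
  have hd : finrank F ↥(⨆ i, U₁ i) ≤ wt K (⨆ i, U₁ i) H + s * finrank F K := by
    have h1 : ⨆ i, U₁ i ≤ ((⨆ i, U₁ i) ⊓ H.restrictScalars F) ⊔ S.sup U₁ := by
      refine iSup_le fun i => ?_
      by_cases hi : i ∈ S
      · exact (Finset.le_sup hi).trans le_sup_right
      · refine le_trans (le_inf (le_iSup U₁ i) ?_) le_sup_left
        rintro _ ⟨x, -, rfl⟩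
        exact Finset.le_sup (f := W) (Finset.mem_compl.2 hi) x.2
    have h2 : finrank F ↥(S.sup U₁) ≤ s * finrank F K := by
      refine (finrank_finset_sup_le S U₁).trans ?_
      rw [← hS, ← smul_eq_mul]
      refine Finset.sum_le_card_nsmul _ _ _ fun i _ => ?_
      have : FiniteDimensional F (W i) := FiniteDimensional.trans F K (W i)
      exact (Submodule.finrank_map_le _ _).trans ((hU' i).1.finrank_le (hWd i) hn)
    exact (Submodule.finrank_mono h1).trans
      ((Submodule.finrank_add_le_finrank_add_finrank _ _).trans (Nat.add_le_add_left h2 _))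
  have hle : wt K (⨆ i, U₁ i) H ≤ sSup {w | ∃ H : Submodule K V,
      finrank K H + s * (h + 1) = finrank K V ∧ w = wt K (⨆ i, U₁ i) H} := by
    refine le_csSup ⟨finrank F ↥(⨆ i, U₁ i), ?_⟩ ⟨H, hH, rfl⟩
    rintro _ ⟨H, -, rfl⟩
    exact Submodule.finrank_mono inf_le_left
  change finrank F ↥(⨆ i, U₁ i) - sSup {w | ∃ H : Submodule K V,
      finrank K H + s * (h + 1) = finrank K V ∧ w = wt K (⨆ i, U₁ i) H} ≤ _
  omega

end DirectSum

/-! ### Weights of subspaces in `V_{A,h}` -/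

section FamilyWeights

variable {F K : Type*} [Field F] [Fintype F] [Field K] [Algebra F K] {m : ℕ} [NeZero m]

theorem vectorMap_apply_lt {h : ℕ} (α : Fin m → K) (x : Fin m → K) {j : Fin (h + 1)}
    (hj : (j : ℕ) < h) (i : Fin m) :
    vectorMap F h α x (j, i) = x i ^ Fintype.card F ^ (j : ℕ) := if_pos hj

theorem vectorMap_apply_last {h : ℕ} (α : Fin m → K) (x : Fin m → K) (i : Fin m) :
    vectorMap F h α x (Fin.last h, i) = x i ^ Fintype.card F ^ h
      + α (i + 1) * x (i + 1) ^ Fintype.card F ^ (h + 1) := if_neg (lt_irrefl h)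

theorem vectorMap_injective {h : ℕ} (hh : 0 < h) (α : Fin m → K) :
    Function.Injective (vectorMap F h α) := by
  intro x y hxy
  ext i
  have h1 := congrFun hxy (0, i)
  rw [vectorMap_apply_lt α x (j := 0) hh, vectorMap_apply_lt α y (j := 0) hh] at h1
  simpa using h1

theorem finrank_subspaceV [FiniteDimensional F K] {h : ℕ} (hh : 0 < h) (α : Fin m → K) :
    finrank F (subspaceV F h α) = m * finrank F K := by
  rw [subspaceV, LinearMap.finrank_range_of_inj (vectorMap_injective hh α),
    Module.finrank_pi_fintype, Finset.sum_const, Finset.card_univ, Fintype.card_fin, smul_eq_mul]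

/-- The parameters `x ∈ K^m` of the vectors of `V_{A,h}` lying in `H`. -/
noncomputable def paramSpace (F : Type*) {K : Type*} [Field F] [Fintype F] [Field K] [Algebra F K]
    {h : ℕ} (α : Fin m → K) (H : Submodule K (Fin (h + 1) × Fin m → K)) :
    Submodule F (Fin m → K) :=
  (H.restrictScalars F).comap (vectorMap F h α)

theorem finrank_paramSpace {h : ℕ} (hh : 0 < h) (α : Fin m → K)
    (H : Submodule K (Fin (h + 1) × Fin m → K)) :
    finrank F (paramSpace F α H) = wt K (subspaceV F h α) H := by
  rw [(Submodule.equivMapOfInjective _ (vectorMap_injective hh α)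
    (paramSpace F α H)).finrank_eq, paramSpace, Submodule.map_comap_eq, wt, subspaceV]

/-- The functions on the parameters that are induced by `K`-linear functionals on `H`. -/
noncomputable def functionalSpace {h : ℕ} (α : Fin m → K)
    (H : Submodule K (Fin (h + 1) × Fin m → K)) : Submodule K (paramSpace F α H →ₗ[F] K) :=
  LinearMap.range
    ({ toFun := fun f => f.restrictScalars F ∘ₗ
        (vectorMap F h α).restrict (p := paramSpace F α H) (q := H.restrictScalars F) fun _ hx => hx
       map_add' := fun _ _ => rfl
       map_smul' := fun _ _ => rfl } : Dual K H →ₗ[K] (paramSpace F α H →ₗ[F] K))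

theorem finrank_functionalSpace_le {h : ℕ} (α : Fin m → K)
    (H : Submodule K (Fin (h + 1) × Fin m → K)) :
    finrank K (functionalSpace (F := F) α H) ≤ finrank K H :=
  (LinearMap.finrank_range_le _).trans Subspace.dual_finrank_eq.le

theorem mem_functionalSpace {h : ℕ} (α : Fin m → K) (H : Submodule K (Fin (h + 1) × Fin m → K))
    (p : Fin (h + 1) × Fin m) {f : paramSpace F α H →ₗ[F] K}
    (hf : ∀ z, f z = vectorMap F h α z.1 p) : f ∈ functionalSpace α H :=
  ⟨(LinearMap.proj p : (Fin (h + 1) × Fin m → K) →ₗ[K] K) ∘ₗ H.subtype,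
    LinearMap.ext fun z => (hf z).symm⟩

theorem frobSpan_le_functionalSpace {h : ℕ} (α : Fin m → K)
    (H : Submodule K (Fin (h + 1) × Fin m → K)) :
    frobSpan (paramSpace F α H) h ≤ functionalSpace α H :=
  frobSpan_le fun k hk i => mem_functionalSpace α H (⟨k, hk.trans h.lt_succ_self⟩, i) fun z =>
    (vectorMap_apply_lt α z.1 (j := ⟨k, hk.trans h.lt_succ_self⟩) hk i).symm

variable [FiniteDimensional F K]

theorem lt_systemGenWeight_subspaceV {h c s : ℕ} (hh : 0 < h) (hc : 0 < c) (hcs : c + s = m)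
    {α : Fin m → K} (hwt : ∀ H : Submodule K (Fin (h + 1) × Fin m → K),
      finrank K H = c * (h + 1) → wt K (subspaceV F h α) H < c * finrank F K) :
    s * finrank F K < systemGenWeight K (subspaceV F h α) (s * (h + 1)) := by
  have hpos : 0 < c * finrank F K := Nat.mul_pos hc finrank_pos
  have hsup : sSup {w | ∃ H : Submodule K (Fin (h + 1) × Fin m → K),
      finrank K H + s * (h + 1) = finrank K (Fin (h + 1) × Fin m → K) ∧
        w = wt K (subspaceV F h α) H} ≤ c * finrank F K - 1 := by
    refine csSup_le' ?_
    rintro _ ⟨H, hH, rfl⟩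
    refine Nat.le_sub_one_of_lt (hwt H ?_)
    rw [finrank_fintype_fun_eq_card, Fintype.card_prod, Fintype.card_fin, Fintype.card_fin,
      mul_comm _ m] at hH
    have : m * (h + 1) = c * (h + 1) + s * (h + 1) := by rw [← hcs, add_mul]
    omega
  have hm : m * finrank F K = c * finrank F K + s * finrank F K := by rw [← hcs, add_mul]
  rw [systemGenWeight, finrank_subspaceV hh]
  omega

variable [Fintype K]

/-- If the relations among the Frobenius powers of the parameters have a small space of leading
coefficients, there is a subspace of `K^m` of dimension `m - c` stable under the weighted cyclic
shift. -/
theorem exists_isShiftStable {h c : ℕ} (hh : 0 < h) {γ : Fin m → K} (hγ : ∀ i, γ i ≠ 0)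
    {H : Submodule K (Fin (h + 1) × Fin m → K)} (hH : finrank K H = c * (h + 1))
    (hc : finrank K (leadSpace (paramSpace F (fun i => γ i ^ Fintype.card F ^ h) H) (h + 1)) + c
      ≤ m) :
    ∃ T : Submodule K (Fin m → K), finrank K T + c = m ∧ IsShiftStable F γ T := by
  set α : Fin m → K := fun i => γ i ^ Fintype.card F ^ h
  obtain ⟨h1, h2⟩ := leadSpace_zero_stable (Z := paramSpace F α H) hh (α := α)
    (fun i => pow_ne_zero _ (hγ i)) ((finrank_functionalSpace_le α H).trans hH.le)
    (frobSpan_le_functionalSpace α H)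
    (fun i => mem_functionalSpace α H (Fin.last h, i) fun z => by
      rw [vectorMap_apply_last]; rfl) hc
  refine ⟨_, h1, fun a ha => ?_⟩
  obtain ⟨b, hb, hbe⟩ := h2 a ha
  refine ⟨b, hb, fun i => pow_card_pow_injective F h ?_⟩
  simp only [mul_pow, ← pow_mul, ← pow_succ']
  exact hbe i

theorem wt_subspaceV_lt_of_mem_setB {h c s : ℕ} (hh : 0 < h) (hc : 0 < c) (hs : 0 < s)
    (hcs : c + s = m) (hn : (s + 1) * (h + 1) < finrank F K) {α : Fin m → K}
    (hα : α ∈ setB F K m) {H : Submodule K (Fin (h + 1) × Fin m → K)}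
    (hH : finrank K H = c * (h + 1)) : wt K (subspaceV F h α) H < c * finrank F K := by
  by_contra! hle
  rw [← finrank_paramSpace hh] at hle
  have h1 := finrank_leadSpace_le_of_large hcs hn hle
  obtain ⟨γ, rfl⟩ := exists_pow_card_pow_eq_fun (F := F) h α
  have hγ := mem_setB_of_pow hα
  obtain ⟨T, hT, hst⟩ := exists_isShiftStable (F := F) hh hγ.1.1 hH (by omega)
  have hbot : T ≠ ⊥ := by
    rintro rfl
    rw [finrank_bot] at hT
    omega
  rw [hst.eq_top_of_mem_setB hbot hγ, finrank_top, finrank_fin_fun] at hT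
  omega

theorem wt_subspaceV_lt_of_codim_eq {h c : ℕ} (hh : 0 < h)
    (hcs : c + 1 = m) (hn : 2 * h + 2 < finrank F K) {α : Fin m → K}
    (hα : α ∈ setA F K m) {H : Submodule K (Fin (h + 1) × Fin m → K)}
    (hH : finrank K H = c * (h + 1)) : wt K (subspaceV F h α) H < c * finrank F K := by
  by_contra! hle
  rw [← finrank_paramSpace hh] at hle
  have h1 := finrank_leadSpace_le_of_large hcs (by omega) hle
  obtain ⟨γ, rfl⟩ := exists_pow_card_pow_eq_fun (F := F) h α
  have hγ := mem_setA_of_pow hα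
  obtain ⟨T, hT, hst⟩ := exists_isShiftStable (F := F) hh hγ.1 hH (by omega)
  exact hst.notMem_setA_of_finrank_eq_one (by omega) hγ

theorem wt_subspaceV_lt_of_finrank_eq {h : ℕ} (hh : 2 ≤ h) (hn : h + 3 ≤ finrank F K)
    {α : Fin m → K} (hα : α ∈ setA F K m) {H : Submodule K (Fin (h + 1) × Fin m → K)}
    (hH : finrank K H = h + 1) : wt K (subspaceV F h α) H < finrank F K := by
  by_contra! hle
  rw [← finrank_paramSpace (by omega)] at hle
  have h1 := finrank_leadSpace_lt_of_small hh (by omega)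
    (((Submodule.finrank_mono (frobSpan_le_functionalSpace α H)).trans
      (finrank_functionalSpace_le α H)).trans hH.le) (hn.trans hle)
  obtain ⟨γ, rfl⟩ := exists_pow_card_pow_eq_fun (F := F) h α
  have hγ := mem_setA_of_pow hα
  obtain ⟨T, hT, hst⟩ := exists_isShiftStable (F := F) (c := 1) (by omega) hγ.1 (by omega) h1
  exact hst.notMem_setA_of_finrank_add_one hT hγ

end FamilyWeights

theorem mainTheorem4 {F K : Type*} [Field F] [Fintype F] [Field K] [Algebra F K]
    (n m h : ℕ) [NeZero m] (hn : Module.finrank F K = n) (hm : 3 ≤ m) (hh : 2 ≤ h)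
    (hhn : h + 3 ≤ n)
    {t : ℕ} (U : Submodule F (Fin (h + 1) × Fin m → K))
    (hU : IsDirectSumOfMaximumHScattered K h m U)
    (C : Submodule K (Fin t → K)) (hC : IsAssociated U C)
    {t' : ℕ} (α : Fin m → K) (G : Submodule K (Fin t' → K))
    (hG : IsAssociated (subspaceV F h α) G) :
    (∀ s : ℕ, 2 ≤ s → s ≤ m - 2 → (s + 1) * (h + 1) < n → α ∈ setB F K m →
      codeGenWeight F C (s * (h + 1)) < codeGenWeight F G (s * (h + 1))) ∧
    (2 * h + 2 < n → α ∈ setA F K m →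
      codeGenWeight F C (h + 1) < codeGenWeight F G (h + 1)) ∧
    (α ∈ setA F K m →
      codeGenWeight F C ((m - 1) * (h + 1)) < codeGenWeight F G ((m - 1) * (h + 1))) := by
  subst hn
  have : FiniteDimensional F K := Module.finite_of_finrank_pos (by omega)
  have : Finite K := Module.finite_of_finite F
  have : Fintype K := Fintype.ofFinite K
  have key : ∀ c s : ℕ, 0 < c → c + s = m →
      (∀ H : Submodule K (Fin (h + 1) × Fin m → K),
        finrank K H = c * (h + 1) → wt K (subspaceV F h α) H < c * finrank F K) →
      codeGenWeight F C (s * (h + 1)) < codeGenWeight F G (s * (h + 1)) := by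
    intro c s hc hcs hwt
    rw [hC.codeGenWeight_eq, hG.codeGenWeight_eq]
    refine lt_of_le_of_lt (hU.systemGenWeight_le ?_ (by omega) (by omega))
      (lt_systemGenWeight_subspaceV (by omega) hc hcs hwt)
    rw [finrank_fintype_fun_eq_card, Fintype.card_prod, Fintype.card_fin, Fintype.card_fin,
      mul_comm]
  refine ⟨fun s hs hsm hsn hα => ?_, fun hn hα => ?_, fun hα => ?_⟩
  · exact key (m - s) s (by omega) (by omega) fun H hH =>
      wt_subspaceV_lt_of_mem_setB (by omega) (by omega) (by omega) (by omega) hsn hα hH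
  · have := key (m - 1) 1 (by omega) (by omega) fun H hH =>
      wt_subspaceV_lt_of_codim_eq (by omega) (by omega) hn hα hH
    rwa [one_mul] at this
  · refine key 1 (m - 1) one_pos (by omega) fun H hH => ?_
    rw [one_mul] at hH ⊢
    exact wt_subspaceV_lt_of_finrank_eq hh hhn hα hH
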